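/- Let $L>0$, $\nu\in\mathbb R$, $c_0\in\mathbb R$ and $\omega\in\mathbb Z\setminus\{0\}$, and let $\beta\in C^\infty(\mathbb R)$ satisfy $\beta>0$. For $\mu>0$ and $\theta,\rho\in W^{1,2}(0,L)$ put $$\mathcal E_\mu(\theta,\rho)=\frac12\int_0^L\Big(\beta(\rho)\,(\partial_s\theta-c_0)^2+\mu\,(\partial_s\rho)^2\Big)\,ds .$$ Let $\mathcal A$ be the set of all pairs $(\theta,\rho)$ with $\theta,\rho\in W^{1,2}(0,L)$ such that $$\theta(L)-\theta(0)=2\pi\omega,\quad \rho(L)=\rho(0),\quad \int_0^L\cos\theta\,ds=\int_0^L\sin\theta\,ds=0,\quad \int_0^L\rho\,ds=\nu L .$$ (Elements of $W^{1,2}(0,L)$ are identified with their continuous representatives on $[0,L]$.) Let $\theta_c(s)=\frac{2\pi\omega}{L}s$ be the angle function of the $\omega$-fold covered circle of length $L$, and let $\rho_c\equiv\nu$. Then $(\theta_c,\rho_c)\in\mathcal A$ and $\int_0^L\theta_c\,ds=\pi\omega L$. Moreover, there exists $\mu_0\in(0,\infty)$, depending only on $L,\nu,c_0,\omega$ and $\beta$,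 such that for every $\mu\ge\mu_0$ $$\mathcal E_\mu(\theta_c,\rho_c)<\mathcal E_\mu(\theta,\rho)$$ for all $(\theta,\rho)\in\mathcal A$ with $\int_0^L\theta\,ds=\pi\omega L$ and $(\theta,\rho)\neq(\theta_c,\rho_c)$. That is, $(\theta_c,\rho_c)$ is the unique global minimizer of $\mathcal E_\mu$ among the pairs in $\mathcal A$ with $\int_0^L\theta\,ds=\pi\omega L$. -/

import Mathlib

open MeasureTheory Set

noncomputable section

namespace HeteroElastic

/-- Lebesgue measure on the open interval `(0, L)`. -/
def vol (L : ℝ) : Measure ℝ := volume.restrict (Ioo 0 L)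

/-- `g ∈ L²(0, L)` is a weak derivative of `u` on `(0, L)`:
`∫ u φ' = -∫ g φ` for all `φ ∈ C_c^∞((0, L))`. -/
def IsWeakDeriv (L : ℝ) (u g : ℝ → ℝ) : Prop :=
  MemLp g 2 (vol L) ∧
    ∀ φ : ℝ → ℝ, ContDiff ℝ (⊤ : ℕ∞) φ → HasCompactSupport φ → tsupport φ ⊆ Ioo 0 L →
      ∫ s in (0 : ℝ)..L, u s * deriv φ s = -∫ s in (0 : ℝ)..L, g s * φ s

/-- Membership in the Sobolev space `W^{1,2}(0, L)`. Every element of that space has a unique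
representative which is continuous on `[0, L]`, and `u` stands for this representative, so that the
boundary values `u 0` and `u L` make sense. The values of `u` outside `[0, L]` are irrelevant. -/
def MemW12 (L : ℝ) (u : ℝ → ℝ) : Prop :=
  ContinuousOn u (Icc 0 L) ∧ MemLp u 2 (vol L) ∧ ∃ g : ℝ → ℝ, IsWeakDeriv L u g

open Classical in
/-- The weak derivative `∂ₛ u` on `(0, L)`, unique up to null sets (`isWeakDeriv_ae_unique`);
set to `0` if `u` does not have one. -/
def weakDeriv (L : ℝ) (u : ℝ → ℝ) : ℝ → ℝ :=
  if h : ∃ g : ℝ → ℝ, IsWeakDeriv L u g then h.choose else 0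

theorem isWeakDeriv_weakDeriv {L : ℝ} {u : ℝ → ℝ} (h : MemW12 L u) :
    IsWeakDeriv L u (weakDeriv L u) := by
  unfold weakDeriv
  rw [dif_pos h.2.2]
  exact h.2.2.choose_spec

theorem isWeakDeriv_ae_unique {L : ℝ} (hL : 0 < L) {u g₁ g₂ : ℝ → ℝ}
    (h₁ : IsWeakDeriv L u g₁) (h₂ : IsWeakDeriv L u g₂) : g₁ =ᵐ[vol L] g₂ := by
  have : IsFiniteMeasure (vol L) := by unfold vol; infer_instance
  have i₁ : Integrable g₁ (vol L) := h₁.1.integrable (by norm_num)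
  have i₂ : Integrable g₂ (vol L) := h₂.1.integrable (by norm_num)
  have key := isOpen_Ioo.ae_eq_zero_of_integral_contDiff_smul_eq_zero (μ := volume)
    (U := Ioo 0 L) (f := fun s => g₁ s - g₂ s)
    (IntegrableOn.locallyIntegrableOn (i₁.sub i₂)) (by
      intro φ hφ hc hs
      have e := (h₁.2 φ hφ hc hs).symm.trans (h₂.2 φ hφ hc hs)
      rw [neg_inj, intervalIntegral.integral_of_le hL.le, intervalIntegral.integral_of_le hL.le,
        integral_Ioc_eq_integral_Ioo, integral_Ioc_eq_integral_Ioo] at e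
      obtain ⟨C, hC⟩ := hc.exists_bound_of_continuous hφ.continuous
      have b : ∀ g : ℝ → ℝ, Integrable g (vol L) → Integrable (fun s => g s * φ s) (vol L) :=
        fun g hg => hg.mul_bdd hφ.continuous.aestronglyMeasurable (ae_of_all _ hC)
      have e' : ∫ s in Ioo 0 L, φ s • (g₁ s - g₂ s) = 0 := by
        have : ∀ s, φ s • (g₁ s - g₂ s) = g₁ s * φ s - g₂ s * φ s := by
          intro s; simp only [smul_eq_mul]; ring
        simp only [this]
        exact (integral_sub (b g₁ i₁) (b g₂ i₂)).trans (sub_eq_zero.mpr e)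
      rw [← e']
      refine (setIntegral_eq_integral_of_forall_compl_eq_zero fun x hx => ?_).symm
      rw [image_eq_zero_of_notMem_tsupport fun h => hx (hs h), zero_smul])
  unfold vol
  rw [Filter.EventuallyEq, ae_restrict_iff' measurableSet_Ioo]
  filter_upwards [key] with s hs hs'
  exact sub_eq_zero.mp (hs hs')

/-- The energy `ℰ_μ(θ, ρ) = ½ ∫₀ᴸ (β(ρ) (∂ₛθ - c₀)² + μ (∂ₛρ)²) ds`. -/
def energy (L : ℝ) (β : ℝ → ℝ) (c₀ μ : ℝ) (θ ρ : ℝ → ℝ) : ℝ :=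
  (1 / 2) * ∫ s in (0 : ℝ)..L,
    (β (ρ s) * (weakDeriv L θ s - c₀) ^ 2 + μ * (weakDeriv L ρ s) ^ 2)

/-- `(θ, ρ)` lies in the admissible set `𝒜`: both functions are in `W^{1,2}(0, L)`,
`θ` is the inclination angle of a closed curve of rotation index `ω`, and `ρ` is a periodic density
of total mass `ν L`. -/
structure Admissible (L ν : ℝ) (ω : ℤ) (θ ρ : ℝ → ℝ) : Prop where
  memW12_angle : MemW12 L θ
  memW12_density : MemW12 L ρ
  rotation : θ L - θ 0 = 2 * Real.pi * ω
  periodic : ρ L = ρ 0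
  closed_cos : ∫ s in (0 : ℝ)..L, Real.cos (θ s) = 0
  closed_sin : ∫ s in (0 : ℝ)..L, Real.sin (θ s) = 0
  mass : ∫ s in (0 : ℝ)..L, ρ s = ν * L

/-- The angle function `θ_c(s) = 2πωs/L` of the `ω`-fold covered circle of length `L`. -/
def thetaC (L : ℝ) (ω : ℤ) : ℝ → ℝ := fun s => 2 * Real.pi * ω * s / L

/-- The constant density `ρ_c = ν`. -/
def rhoC (ν : ℝ) : ℝ → ℝ := fun _ => ν

end HeteroElastic

end

namespace HeteroElastic

/-! Write `a = 2πω/L - c₀`, `η = ρ - ν`, `r = ∂ₛ(θ - θ_c)`, `Q = ∫ (∂ₛρ)²`. Both `η` and `r` have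
integral zero, and by the Poincaré inequality `sq_le_mul_integral_sq` one has `η² ≤ L Q` pointwise.
If `L Q ≥ 1`, then `μ Q` alone exceeds the circle's `β(ν) a² L` once `μ` is large. Otherwise `|η| ≤
1`, and `β` can be expanded at `ν` with uniform constants (`exists_local_bounds`). The terms linear
in `η` and `r` integrate to zero, the mixed term is absorbed by Young's inequality
(`energy_density_lower_bound`), and what remains is at least `(m/2) ∫ r² - C ∫ η²`. Since `∫ η² ≤ L²
Q`, a large `μ` wins. Equality would force `r = 0` and `∂ₛρ = 0` a.e., hence the circle, because the
mean of `θ` is prescribed. -/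

/-! ### Weak derivatives and the fundamental theorem of calculus -/

theorem exists_test_primitive {a b : ℝ} {ψ : ℝ → ℝ} (hψ : ContDiff ℝ (⊤ : ℕ∞) ψ)
    (hs : tsupport ψ ⊆ Ioo a b) (hc : HasCompactSupport ψ) (h0 : ∫ s in a..b, ψ s = 0) :
    ∃ φ : ℝ → ℝ, ContDiff ℝ (⊤ : ℕ∞) φ ∧ HasCompactSupport φ ∧ tsupport φ ⊆ Ioo a b ∧
      deriv φ = ψ := by
  have hd : ∀ x, HasDerivAt (fun x => ∫ s in a..x, ψ s) (ψ x) x := fun x =>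
    intervalIntegral.integral_hasDerivAt_right (hψ.continuous.intervalIntegrable _ _)
      (hψ.continuous.stronglyMeasurableAtFilter _ _) hψ.continuous.continuousAt
  have hderiv : deriv (fun x => ∫ s in a..x, ψ s) = ψ := funext fun x => (hd x).deriv
  have hsupp : ∃ c d, a < c ∧ d < b ∧ tsupport ψ ⊆ Icc c d := by
    rcases (tsupport ψ).eq_empty_or_nonempty with he | hne
    · exact ⟨a + 1, b - 1, by linarith, by linarith, by simp [he]⟩
    · obtain ⟨c, hc1, hc2⟩ := hc.exists_isLeast hne
      obtain ⟨d, hd1, hd2⟩ := hc.exists_isGreatest hne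
      exact ⟨c, d, (hs hc1).1, (hs hd1).2, fun x hx => ⟨hc2 hx, hd2 hx⟩⟩
  obtain ⟨c, d, hac, hdb, hcd⟩ := hsupp
  have hz : ∀ x, x ∉ Icc c d → ψ x = 0 := fun x hx =>
    image_eq_zero_of_notMem_tsupport fun h => hx (hcd h)
  -- Left of `c` the integrand vanishes; right of `d` the primitive is the total integral, which is
  -- zero by `h0`.
  have hsub : tsupport (fun x => ∫ s in a..x, ψ s) ⊆ Icc c d := by
    refine closure_minimal (fun x hx => ?_) isClosed_Icc
    by_contra hx'
    apply hx
    rcases not_and_or.mp hx' with h | h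
    · push Not at h
      refine intervalIntegral.integral_zero_ae (ae_of_all _ fun s hs' => hz s fun hs'' => ?_)
      have := (uIoc_subset_uIcc hs')
      rw [mem_uIcc] at this
      rcases this with h | h <;> linarith [hs''.1]
    · push Not at h
      rw [← intervalIntegral.integral_add_adjacent_intervals
        (hψ.continuous.intervalIntegrable a x) (hψ.continuous.intervalIntegrable x b)] at h0
      have : ∫ s in x..b, ψ s = 0 := by
        refine intervalIntegral.integral_zero_ae (ae_of_all _ fun s hs' => hz s fun hs'' => ?_)
        have := (uIoc_subset_uIcc hs')
        rw [mem_uIcc] at this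
        rcases this with h | h <;> linarith [hs''.2]
      simpa [this] using h0
  refine ⟨_, ?_, isCompact_Icc.of_isClosed_subset (isClosed_tsupport _) hsub,
    hsub.trans fun x hx => ⟨hac.trans_le hx.1, hx.2.trans_lt hdb⟩, hderiv⟩
  refine contDiff_infty_iff_deriv.mpr ⟨fun x => (hd x).differentiableAt, ?_⟩
  rw [hderiv]
  exact hψ

/-- The lemma of du Bois-Reymond. -/
theorem exists_eqOn_const_of_integral_mul_deriv_eq_zero {a b : ℝ} (hab : a < b) {w : ℝ → ℝ}
    (hw : ContinuousOn w (Icc a b))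
    (h : ∀ φ : ℝ → ℝ, ContDiff ℝ (⊤ : ℕ∞) φ → HasCompactSupport φ → tsupport φ ⊆ Ioo a b →
      ∫ s in a..b, w s * deriv φ s = 0) :
    ∃ c, ∀ x ∈ Icc a b, w x = c := by
  have hm : (a + b) / 2 ∈ Ioo a b := ⟨by linarith, by linarith⟩
  obtain ⟨f, hfs, hfc, hfd, hfr, hf1⟩ :=
    exists_contDiff_tsupport_subset (n := (⊤ : ℕ∞)) (isOpen_Ioo.mem_nhds hm)
  have hpos : 0 < ∫ s in a..b, f s := by
    refine intervalIntegral.integral_pos hab hfd.continuous.continuousOn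
      (fun x _ => (hfr ⟨x, rfl⟩).1) ⟨_, Ioo_subset_Icc_self hm, by rw [hf1]; exact one_pos⟩
  set F := ∫ s in a..b, f s with hF
  set W := ∫ s in a..b, w s * f s with hW
  -- If `w` is constant, testing against the bump `f` shows that the constant is `W / F`.
  refine ⟨W / F, ?_⟩
  have hwu : ContinuousOn w (uIcc a b) := by rwa [uIcc_of_le hab.le]
  have key := isOpen_Ioo.ae_eq_zero_of_integral_contDiff_smul_eq_zero (μ := volume)
    (U := Ioo a b) (f := fun s => w s - W / F)
    (((hw.sub continuousOn_const).mono Ioo_subset_Icc_self).locallyIntegrableOn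
      measurableSet_Ioo) (by
      intro φ hφ hc hs
      set I := ∫ s in a..b, φ s with hI
      have iφ : IntervalIntegrable φ volume a b := hφ.continuous.intervalIntegrable _ _
      have jf : IntervalIntegrable f volume a b := hfd.continuous.intervalIntegrable _ _
      have hts : tsupport (fun s => φ s - I / F * f s) ⊆ Ioo a b := by
        refine (tsupport_sub φ (fun s => I / F * f s)).trans (union_subset hs ?_)
        exact (tsupport_mul_subset_right).trans hfs
      -- Subtracting the multiple `I / F` of `f` makes the integral zero, so the corrected `φ` is
      -- the derivative of a test function.
      obtain ⟨χ, c1, c2, c3, c4⟩ := exists_test_primitive (a := a) (b := b)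
        (ψ := fun s => φ s - I / F * f s) (hφ.sub (contDiff_const.mul hfd)) hts
        (hc.sub hfc.mul_left) (by
          rw [intervalIntegral.integral_sub iφ (jf.const_mul _),
            intervalIntegral.integral_const_mul, ← hF, ← hI]
          field_simp
          ring)
      have e := h χ c1 c2 c3
      rw [c4] at e
      have iwφ : IntervalIntegrable (fun s => w s * φ s) volume a b :=
        (hwu.mul hφ.continuous.continuousOn).intervalIntegrable
      have iwf : IntervalIntegrable (fun s => w s * f s) volume a b :=
        (hwu.mul hfd.continuous.continuousOn).intervalIntegrable
      have e2 : ∫ s in a..b, (w s * φ s - I / F * (w s * f s)) = 0 := by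
        rw [← e]; congr 1; ext s; ring
      rw [intervalIntegral.integral_sub iwφ (iwf.const_mul _),
        intervalIntegral.integral_const_mul, ← hW] at e2
      have e3 : ∫ s in a..b, φ s • (w s - W / F) = 0 := by
        have : ∀ s, φ s • (w s - W / F) = w s * φ s - W / F * φ s := by
          intro s; simp only [smul_eq_mul]; ring
        simp only [this]
        rw [intervalIntegral.integral_sub iwφ (iφ.const_mul _),
          intervalIntegral.integral_const_mul, ← hI]
        linear_combination e2
      rw [intervalIntegral.integral_of_le hab.le, integral_Ioc_eq_integral_Ioo] at e3
      rw [← e3]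
      refine (setIntegral_eq_integral_of_forall_compl_eq_zero fun x hx => ?_).symm
      rw [image_eq_zero_of_notMem_tsupport fun h => hx (hs h), zero_smul])
  refine Measure.eqOn_Icc_of_ae_eq volume hab.ne ?_ hw continuousOn_const
  rw [← restrict_Ioo_eq_restrict_Icc, Filter.EventuallyEq, ae_restrict_iff' measurableSet_Ioo]
  filter_upwards [key] with s hs hs'
  exact sub_eq_zero.mp (hs hs')

theorem IsWeakDeriv.intervalIntegrable_sq {L : ℝ} (hL : 0 < L) {u g : ℝ → ℝ}
    (h : IsWeakDeriv L u g) : IntervalIntegrable (fun s => g s ^ 2) volume 0 L := by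
  rw [intervalIntegrable_iff_integrableOn_Ioo_of_le hL.le]
  exact h.1.integrable_sq

theorem IsWeakDeriv.intervalIntegrable {L : ℝ} (hL : 0 < L) {u g : ℝ → ℝ}
    (h : IsWeakDeriv L u g) : IntervalIntegrable g volume 0 L := by
  rw [intervalIntegrable_iff_integrableOn_Ioo_of_le hL.le]
  have : IsFiniteMeasure (vol L) := by unfold vol; infer_instance
  exact h.1.integrable (by norm_num)

/-- Integration by parts for absolutely continuous functions; the boundary term at `a` vanishes
because the primitive starts there. -/
theorem integral_primitive_mul_deriv {a b : ℝ} {g φ : ℝ → ℝ}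
    (hg : IntervalIntegrable g volume a b) (hφ : ContDiff ℝ 1 φ) (hb : φ b = 0) :
    ∫ s in a..b, (∫ t in a..s, g t) * deriv φ s = -∫ s in a..b, g s * φ s := by
  rw [(hg.absolutelyContinuousOnInterval_intervalIntegral
    left_mem_uIcc).integral_mul_deriv_eq_deriv_mul hφ.contDiffOn.absolutelyContinuousOnInterval]
  simp only [hb, mul_zero, intervalIntegral.integral_same, zero_mul, sub_zero, zero_sub, neg_inj]
  refine intervalIntegral.integral_congr_ae ?_
  filter_upwards [hg.ae_hasDerivAt_integral] with s hs hs'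
  rw [(hs (uIoc_subset_uIcc hs') a left_mem_uIcc).deriv]

/-- The fundamental theorem of calculus for weak derivatives. -/
theorem IsWeakDeriv.eq_add_integral {L : ℝ} (hL : 0 < L) {u g : ℝ → ℝ}
    (hu : ContinuousOn u (Icc 0 L)) (h : IsWeakDeriv L u g) {x : ℝ} (hx : x ∈ Icc 0 L) :
    u x = u 0 + ∫ s in (0 : ℝ)..x, g s := by
  have ig := h.intervalIntegrable hL
  have hG : ContinuousOn (fun x => ∫ s in (0 : ℝ)..x, g s) (uIcc 0 L) :=
    (ig.absolutelyContinuousOnInterval_intervalIntegral left_mem_uIcc).continuousOn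
  have hu' : ContinuousOn u (uIcc 0 L) := by rwa [uIcc_of_le hL.le]
  obtain ⟨c, hc⟩ := exists_eqOn_const_of_integral_mul_deriv_eq_zero hL
    (w := fun x => u x - ∫ s in (0 : ℝ)..x, g s) (by
      rw [uIcc_of_le hL.le] at hG; exact hu.sub hG) (by
      intro φ hφ hcs hs
      have hd : Continuous (deriv φ) := hφ.continuous_deriv (by simp)
      have e1 := h.2 φ hφ hcs hs
      have e2 := integral_primitive_mul_deriv ig (hφ.of_le (by simp))
        (image_eq_zero_of_notMem_tsupport fun h => (hs h).2.false)
      have i1 : IntervalIntegrable (fun s => u s * deriv φ s) volume 0 L :=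
        (hu'.mul hd.continuousOn).intervalIntegrable
      have i2 : IntervalIntegrable (fun s => (∫ t in (0 : ℝ)..s, g t) * deriv φ s) volume 0 L :=
        (hG.mul hd.continuousOn).intervalIntegrable
      simp only [sub_mul]
      rw [intervalIntegral.integral_sub i1 i2, e1, e2, sub_self])
  have h0 := hc 0 (left_mem_Icc.mpr hL.le)
  have h1 := hc x hx
  simp only [intervalIntegral.integral_same] at h0 h1
  linarith

/-! ### Poincaré inequality -/

/-- Cauchy–Schwarz, from expanding the variance of `|g|` about its mean `A / L`. -/
theorem sq_integral_abs_le {L : ℝ} (hL : 0 < L) {g : ℝ → ℝ}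
    (hg : IntervalIntegrable g volume 0 L)
    (hg2 : IntervalIntegrable (fun s => g s ^ 2) volume 0 L) :
    (∫ s in (0 : ℝ)..L, |g s|) ^ 2 ≤ L * ∫ s in (0 : ℝ)..L, g s ^ 2 := by
  set A := ∫ s in (0 : ℝ)..L, |g s| with hA
  have h0 : 0 ≤ ∫ s in (0 : ℝ)..L, (|g s| - A / L) ^ 2 :=
    intervalIntegral.integral_nonneg hL.le fun s _ => sq_nonneg _
  have he : ∀ s, (|g s| - A / L) ^ 2 = g s ^ 2 - 2 * A / L * |g s| + (A / L) ^ 2 := by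
    intro s
    rw [← sq_abs (g s)]
    ring
  simp only [he] at h0
  rw [intervalIntegral.integral_add (hg2.sub (hg.abs.const_mul _)) intervalIntegrable_const,
    intervalIntegral.integral_sub hg2 (hg.abs.const_mul _), intervalIntegral.integral_const_mul,
    ← hA, intervalIntegral.integral_const, smul_eq_mul, sub_zero] at h0
  have : L * ((∫ s in (0 : ℝ)..L, g s ^ 2) - 2 * A / L * A + L * (A / L) ^ 2)
      = L * (∫ s in (0 : ℝ)..L, g s ^ 2) - A ^ 2 := by
    field_simp
    ring
  nlinarith [mul_nonneg hL.le h0]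

/-- A Poincaré inequality with pointwise control. -/
theorem sq_le_mul_integral_sq {L : ℝ} (hL : 0 < L) {u g : ℝ → ℝ}
    (hu : ContinuousOn u (Icc 0 L)) (h0 : ∫ s in (0 : ℝ)..L, u s = 0)
    (hg : IntervalIntegrable g volume 0 L)
    (hg2 : IntervalIntegrable (fun s => g s ^ 2) volume 0 L)
    (hug : ∀ x ∈ Icc 0 L, u x = u 0 + ∫ s in (0 : ℝ)..x, g s) {x : ℝ} (hx : x ∈ Icc 0 L) :
    u x ^ 2 ≤ L * ∫ s in (0 : ℝ)..L, g s ^ 2 := by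
  refine le_trans ?_ (sq_integral_abs_le hL hg hg2)
  set A := ∫ s in (0 : ℝ)..L, |g s| with hA
  -- Since `u` has mean zero, `u x` is the average of `u x - u y` over `y`, so bounding the
  -- oscillation is enough.
  have hdiff : ∀ y ∈ Icc 0 L, |u x - u y| ≤ A := by
    intro y hy
    have hx' : IntervalIntegrable g volume 0 x := hg.mono_set (by
      rw [uIcc_of_le hx.1, uIcc_of_le hL.le]; exact Icc_subset_Icc_right hx.2)
    have hy' : IntervalIntegrable g volume 0 y := hg.mono_set (by
      rw [uIcc_of_le hy.1, uIcc_of_le hL.le]; exact Icc_subset_Icc_right hy.2)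
    rw [hug x hx, hug y hy, add_sub_add_left_eq_sub,
      intervalIntegral.integral_interval_sub_left hx' hy']
    refine (intervalIntegral.norm_integral_le_integral_norm_uIoc (f := g)).trans ?_
    rw [hA, intervalIntegral.integral_of_le hL.le]
    refine setIntegral_mono_set hg.abs.1 (ae_of_all _ fun s => abs_nonneg _)
      (LE.le.eventuallyLE ?_)
    rw [uIoc]
    exact Ioc_subset_Ioc (le_min hy.1 hx.1) (max_le hy.2 hx.2)
  have hui : IntervalIntegrable u volume 0 L :=
    ContinuousOn.intervalIntegrable (by rwa [uIcc_of_le hL.le])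
  have hmean : ∫ s in (0 : ℝ)..L, (u x - u s) = L * u x := by
    rw [intervalIntegral.integral_sub intervalIntegrable_const hui, h0,
      intervalIntegral.integral_const, smul_eq_mul]
    ring
  have hb := intervalIntegral.norm_integral_le_of_norm_le_const (a := 0) (b := L) (C := A)
    (f := fun s => u x - u s) fun y hy =>
      hdiff y (Ioc_subset_Icc_self (by rwa [uIoc_of_le hL.le] at hy))
  rw [hmean, Real.norm_eq_abs, sub_zero, abs_mul, abs_of_pos hL, mul_comm] at hb
  exact sq_le_sq' (by linarith [neg_abs_le (u x), le_of_mul_le_mul_right hb hL])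
    ((le_abs_self _).trans (le_of_mul_le_mul_right hb hL))

/-! ### Pointwise estimates for the energy density -/

/-- By compactness of `[ν - 1, ν + 1]`: `m` is the minimum of `β` there and `K` bounds both `|β'|`
and `|β''|`. Only the lower half of the Taylor estimate is needed. -/
theorem exists_local_bounds {β : ℝ → ℝ} (hβ : ContDiff ℝ 2 β) (hβpos : ∀ x, 0 < β x) (ν : ℝ) :
    ∃ m K : ℝ, 0 < m ∧ 0 ≤ K ∧ ∀ x, |x - ν| ≤ 1 → m ≤ β x ∧ |β x - β ν| ≤ K * |x - ν| ∧
      deriv β ν * (x - ν) - K * (x - ν) ^ 2 ≤ β x - β ν := by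
  have hβ' : ContDiff ℝ 1 (deriv β) := (contDiff_succ_iff_deriv (n := 1)).mp hβ |>.2.2
  have hd : Differentiable ℝ β := hβ.differentiable (by simp)
  have hd' : Differentiable ℝ (deriv β) := hβ'.differentiable (by simp)
  have hcI : IsCompact (Icc (ν - 1) (ν + 1)) := isCompact_Icc
  have hν : ν ∈ Icc (ν - 1) (ν + 1) := ⟨by linarith, by linarith⟩
  obtain ⟨y, -, hy⟩ := hcI.exists_isMinOn ⟨ν, hν⟩ hβ.continuous.continuousOn
  obtain ⟨C₁, hC₁⟩ := hcI.exists_bound_of_continuousOn hβ'.continuous.continuousOn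
  obtain ⟨C₂, hC₂⟩ := hcI.exists_bound_of_continuousOn
    (hβ'.continuous_deriv le_rfl).continuousOn
  have hlip : ∀ x ∈ Icc (ν - 1) (ν + 1), |deriv β x - deriv β ν| ≤ C₂ * |x - ν| := fun x hx =>
    (convex_Icc (ν - 1) (ν + 1)).norm_image_sub_le_of_norm_deriv_le
      (fun z _ => hd' z) hC₂ hν hx
  refine ⟨β y, max C₁ C₂, hβpos y,
    le_max_of_le_left ((norm_nonneg _).trans (hC₁ ν hν)), fun x hx => ?_⟩
  have hxI : x ∈ Icc (ν - 1) (ν + 1) := by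
    rw [abs_le] at hx; exact ⟨by linarith, by linarith⟩
  refine ⟨hy hxI, ?_, ?_⟩
  · exact ((convex_Icc (ν - 1) (ν + 1)).norm_image_sub_le_of_norm_deriv_le
      (fun z _ => hd z) hC₁ hν hxI).trans
        (mul_le_mul_of_nonneg_right (le_max_left _ _) (norm_nonneg _))
  · have hC₂0 : 0 ≤ C₂ := (norm_nonneg _).trans (hC₂ ν hν)
    have hsub : uIcc ν x ⊆ Icc (ν - 1) (ν + 1) := uIcc_subset_Icc hν hxI
    -- The mean value inequality for `β` minus its linear part, whose derivative is at most `C₂ |x -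
    -- ν|` between `ν` and `x`.
    have hder : ∀ z ∈ uIcc ν x,
        HasDerivWithinAt (fun z => β z - deriv β ν * z) (deriv β z - deriv β ν) (uIcc ν x) z :=
      fun z _ => ((hd z).hasDerivAt.sub
        (by simpa using (hasDerivAt_id z).const_mul (deriv β ν))).hasDerivWithinAt
    have := (convex_uIcc ν x).norm_image_sub_le_of_norm_hasDerivWithin_le
      (C := C₂ * |x - ν|) hder (fun z hz => (hlip z (hsub hz)).trans
        (mul_le_mul_of_nonneg_left (abs_sub_left_of_mem_uIcc hz) hC₂0))
      left_mem_uIcc right_mem_uIcc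
    rw [Real.norm_eq_abs, Real.norm_eq_abs, mul_assoc, ← sq, sq_abs] at this
    have h1 := neg_abs_le (β x - deriv β ν * x - (β ν - deriv β ν * ν))
    have h2 := mul_le_mul_of_nonneg_right (le_max_right C₁ C₂) (sq_nonneg (x - ν))
    linarith

/-- Used with `b = β(ρ)`, `B = β(ν)`, `d = β'(ν)`, `η = ρ - ν`. Expand `b (a + r)²` around `B`; the
terms linear in `η` or `r` are kept exactly because they integrate to zero. -/
theorem energy_density_lower_bound {m K a b B η r : ℝ} {d : ℝ} (hm : 0 < m) (hb : m ≤ b)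
    (h1 : |b - B| ≤ K * |η|) (h2 : d * η - K * η ^ 2 ≤ b - B) :
    B * a ^ 2 + a ^ 2 * d * η + 2 * a * B * r + m / 2 * r ^ 2
      - (a ^ 2 * K + 2 * a ^ 2 * K ^ 2 / m) * η ^ 2 ≤ b * (a + r) ^ 2 := by
  have h3 : (b - B) ^ 2 ≤ K ^ 2 * η ^ 2 := by
    rw [← sq_abs (b - B), ← sq_abs η, ← mul_pow]
    exact pow_le_pow_left₀ (abs_nonneg _) h1 2
  have h4 : a ^ 2 * (d * η - K * η ^ 2) ≤ a ^ 2 * (b - B) :=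
    mul_le_mul_of_nonneg_left h2 (sq_nonneg a)
  -- Young's inequality, weighted to spend half of the coercive term `m r²`.
  have h5 : -(m / 2 * r ^ 2 + 2 * a ^ 2 / m * (b - B) ^ 2) ≤ 2 * a * (b - B) * r := by
    have : 0 ≤ (m * r + 2 * a * (b - B)) ^ 2 / (2 * m) := by positivity
    have e : (m * r + 2 * a * (b - B)) ^ 2 / (2 * m)
      = m / 2 * r ^ 2 + 2 * a ^ 2 / m * (b - B) ^ 2 + 2 * a * (b - B) * r := by
      field_simp
      ring
    linarith
  have h6 : 2 * a ^ 2 / m * (b - B) ^ 2 ≤ 2 * a ^ 2 / m * (K ^ 2 * η ^ 2) :=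
    mul_le_mul_of_nonneg_left h3 (by positivity)
  have h7 : m * r ^ 2 ≤ b * r ^ 2 := mul_le_mul_of_nonneg_right hb (sq_nonneg r)
  have e : 2 * a ^ 2 * K ^ 2 / m * η ^ 2 = 2 * a ^ 2 / m * (K ^ 2 * η ^ 2) := by ring
  linarith

/-! ### The circle: admissibility and energy -/

theorem isWeakDeriv_deriv (L : ℝ) {u : ℝ → ℝ} (hu : ContDiff ℝ 1 u) :
    IsWeakDeriv L u (deriv u) := by
  have hc : Continuous (deriv u) := hu.continuous_deriv le_rfl
  refine ⟨?_, fun φ hφ _ hs => ?_⟩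
  · obtain ⟨C, hC⟩ := (isCompact_Icc (a := (0 : ℝ)) (b := L)).exists_bound_of_continuousOn
      hc.continuousOn
    have : IsFiniteMeasure (vol L) := by unfold vol; infer_instance
    refine MemLp.of_bound hc.aestronglyMeasurable C ?_
    exact (ae_restrict_iff' measurableSet_Ioo).mpr
      (ae_of_all _ fun s hs => hC s (Ioo_subset_Icc_self hs))
  · have hφ' : ContDiff ℝ 1 φ := hφ.of_le (by simp)
    rw [hu.contDiffOn.absolutelyContinuousOnInterval.integral_mul_deriv_eq_deriv_mul
      hφ'.contDiffOn.absolutelyContinuousOnInterval,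
      image_eq_zero_of_notMem_tsupport fun h => (hs h).2.false,
      image_eq_zero_of_notMem_tsupport fun h => (hs h).1.false]
    ring

theorem memW12_of_contDiff (L : ℝ) {u : ℝ → ℝ} (hu : ContDiff ℝ 1 u) :
    MemW12 L u := by
  refine ⟨hu.continuous.continuousOn, ?_, _, isWeakDeriv_deriv L hu⟩
  obtain ⟨C, hC⟩ := (isCompact_Icc (a := (0 : ℝ)) (b := L)).exists_bound_of_continuousOn
    hu.continuous.continuousOn
  have : IsFiniteMeasure (vol L) := by unfold vol; infer_instance
  refine MemLp.of_bound hu.continuous.aestronglyMeasurable C ?_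
  exact (ae_restrict_iff' measurableSet_Ioo).mpr
    (ae_of_all _ fun s hs => hC s (Ioo_subset_Icc_self hs))

theorem weakDeriv_ae_eq_deriv {L : ℝ} (hL : 0 < L) {u : ℝ → ℝ} (hu : ContDiff ℝ 1 u) :
    weakDeriv L u =ᵐ[vol L] deriv u :=
  isWeakDeriv_ae_unique hL (isWeakDeriv_weakDeriv (memW12_of_contDiff L hu))
    (isWeakDeriv_deriv L hu)

theorem contDiff_thetaC (L : ℝ) (ω : ℤ) : ContDiff ℝ 1 (thetaC L ω) := by
  unfold thetaC
  fun_prop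

theorem deriv_thetaC (L : ℝ) (ω : ℤ) (s : ℝ) :
    deriv (thetaC L ω) s = 2 * Real.pi * ω / L := by
  have : thetaC L ω = fun s => 2 * Real.pi * ω / L * s := by
    ext s
    simp only [thetaC]
    ring
  rw [this]
  simp

theorem integral_thetaC {L : ℝ} (hL : 0 < L) (ω : ℤ) :
    ∫ s in (0 : ℝ)..L, thetaC L ω s = Real.pi * ω * L := by
  have : thetaC L ω = fun s => 2 * Real.pi * ω / L * s := by
    ext s
    simp only [thetaC]
    ring
  rw [this, intervalIntegral.integral_const_mul, integral_id]
  field_simp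
  ring

theorem admissible_circle {L : ℝ} (hL : 0 < L) (ν : ℝ) {ω : ℤ} (hω : ω ≠ 0) :
    Admissible L ν ω (thetaC L ω) (rhoC ν) := by
  have hk : 2 * Real.pi * ω / L ≠ 0 := by
    have : (ω : ℝ) ≠ 0 := by exact_mod_cast hω
    have := Real.pi_ne_zero
    positivity
  have he : ∀ s, thetaC L ω s = 2 * Real.pi * ω / L * s := fun s => by
    simp only [thetaC]
    ring
  have hkL : 2 * Real.pi * ω / L * L = ω * (2 * Real.pi) := by
    field_simp
  refine ⟨memW12_of_contDiff L (contDiff_thetaC L ω), memW12_of_contDiff L contDiff_const,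
    ?_, rfl, ?_, ?_, ?_⟩
  · rw [he, he, hkL]
    ring
  · simp only [he]
    rw [intervalIntegral.integral_comp_mul_left _ hk, integral_cos, hkL,
      ← zero_add ((ω : ℝ) * _), Real.sin_add_int_mul_two_pi]
    simp
  · simp only [he]
    rw [intervalIntegral.integral_comp_mul_left _ hk, integral_sin, hkL,
      ← zero_add ((ω : ℝ) * _), Real.cos_add_int_mul_two_pi]
    simp
  · simp [rhoC, mul_comm]

theorem integral_congr_ae_vol {L : ℝ} (hL : 0 < L) {f g : ℝ → ℝ} (h : f =ᵐ[vol L] g) :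
    ∫ s in (0 : ℝ)..L, f s = ∫ s in (0 : ℝ)..L, g s := by
  rw [intervalIntegral.integral_of_le hL.le, intervalIntegral.integral_of_le hL.le,
    integral_Ioc_eq_integral_Ioo, integral_Ioc_eq_integral_Ioo]
  exact integral_congr_ae h

theorem energy_circle {L : ℝ} (hL : 0 < L) (ν c₀ μ : ℝ) (ω : ℤ) (β : ℝ → ℝ) :
    energy L β c₀ μ (thetaC L ω) (rhoC ν)
      = 1 / 2 * (L * (β ν * (2 * Real.pi * ω / L - c₀) ^ 2)) := by
  have h : (fun s => β (rhoC ν s) * (weakDeriv L (thetaC L ω) s - c₀) ^ 2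
      + μ * (weakDeriv L (rhoC ν) s) ^ 2)
      =ᵐ[vol L] fun _ => β ν * (2 * Real.pi * ω / L - c₀) ^ 2 := by
    filter_upwards [weakDeriv_ae_eq_deriv hL (contDiff_thetaC L ω),
      weakDeriv_ae_eq_deriv (u := rhoC ν) hL contDiff_const] with s h1 h2
    have h3 : deriv (rhoC ν) s = 0 := by unfold rhoC; simp
    rw [h1, h2, h3, deriv_thetaC, rhoC]
    ring
  rw [energy, integral_congr_ae_vol hL h, intervalIntegral.integral_const, smul_eq_mul, sub_zero]

/-! ### Perturbation variables of an admissible pair -/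

/-- The quantities attached to an admissible pair which enter the energy estimate: `r` is the weak
derivative of `θ - θ_c` and `q` the one of `ρ`. -/
theorem Admissible.exists_deriv {L ν : ℝ} {ω : ℤ} {θ ρ : ℝ → ℝ} (hL : 0 < L)
    (h : Admissible L ν ω θ ρ) (hθ : ∫ s in (0 : ℝ)..L, θ s = Real.pi * ω * L) :
    ∃ r q : ℝ → ℝ, IntervalIntegrable r volume 0 L ∧
      IntervalIntegrable (fun s => r s ^ 2) volume 0 L ∧
      IntervalIntegrable (fun s => q s ^ 2) volume 0 L ∧
      (∫ s in (0 : ℝ)..L, r s = 0) ∧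
      (∀ x ∈ Icc 0 L, (θ x - thetaC L ω x) ^ 2 ≤ L * ∫ s in (0 : ℝ)..L, r s ^ 2) ∧
      (∀ x ∈ Icc 0 L, (ρ x - ν) ^ 2 ≤ L * ∫ s in (0 : ℝ)..L, q s ^ 2) ∧
      ∀ β : ℝ → ℝ, ∀ c₀ μ : ℝ, energy L β c₀ μ θ ρ = 1 / 2 * ∫ s in (0 : ℝ)..L,
        (β (ρ s) * ((2 * Real.pi * ω / L - c₀) + r s) ^ 2 + μ * q s ^ 2) := by
  have hp := isWeakDeriv_weakDeriv h.memW12_angle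
  have hq := isWeakDeriv_weakDeriv h.memW12_density
  have hθc := h.memW12_angle.1
  have hρc := h.memW12_density.1
  set p := weakDeriv L θ
  set q := weakDeriv L ρ
  set k := 2 * Real.pi * ω / L with hk
  have ip := hp.intervalIntegrable hL
  have iq := hq.intervalIntegrable hL
  have ip2 := hp.intervalIntegrable_sq hL
  have iq2 := hq.intervalIntegrable_sq hL
  have ir : IntervalIntegrable (fun s => p s - k) volume 0 L := ip.sub intervalIntegrable_const
  have ir2 : IntervalIntegrable (fun s => (p s - k) ^ 2) volume 0 L := by
    have e : (fun s => (p s - k) ^ 2) = fun s => p s ^ 2 - 2 * k * p s + k ^ 2 := by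
      ext s
      ring
    rw [e]
    exact (ip2.sub (ip.const_mul _)).add intervalIntegrable_const
  have hT : ∀ s, thetaC L ω s = k * s := fun s => by
    simp only [thetaC, hk]
    ring
  have iθ : IntervalIntegrable θ volume 0 L :=
    ContinuousOn.intervalIntegrable (by rwa [uIcc_of_le hL.le])
  have iρ : IntervalIntegrable ρ volume 0 L :=
    ContinuousOn.intervalIntegrable (by rwa [uIcc_of_le hL.le])
  have hTc : Continuous (thetaC L ω) := (contDiff_thetaC L ω).continuous
  refine ⟨fun s => p s - k, q, ir, ir2, iq2, ?_, fun x hx => ?_, fun x hx => ?_,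
    fun β c₀ μ => ?_⟩
  · have e := hp.eq_add_integral hL hθc (right_mem_Icc.mpr hL.le)
    rw [intervalIntegral.integral_sub ip intervalIntegrable_const,
      intervalIntegral.integral_const, smul_eq_mul, sub_zero]
    have : L * k = 2 * Real.pi * ω := by
      rw [hk]
      field_simp
    linarith [h.rotation]
  · refine sq_le_mul_integral_sq (u := fun x => θ x - thetaC L ω x) hL
      (hθc.sub hTc.continuousOn) ?_ ir ir2 (fun y hy => ?_) hx
    -- The prescribed mean of `θ` removes the freedom of adding a constant angle.
    · rw [intervalIntegral.integral_sub iθ (hTc.intervalIntegrable _ _), hθ,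
        integral_thetaC hL, sub_self]
    · have iy : IntervalIntegrable p volume 0 y := ip.mono_set (by
        rw [uIcc_of_le hy.1, uIcc_of_le hL.le]; exact Icc_subset_Icc_right hy.2)
      rw [intervalIntegral.integral_sub iy intervalIntegrable_const,
        intervalIntegral.integral_const, smul_eq_mul, hT, hT, hp.eq_add_integral hL hθc hy]
      ring
  · refine sq_le_mul_integral_sq (u := fun x => ρ x - ν) hL
      (hρc.sub continuousOn_const) ?_ iq iq2 (fun y hy => ?_) hx
    · rw [intervalIntegral.integral_sub iρ intervalIntegrable_const, h.mass,
        intervalIntegral.integral_const, smul_eq_mul]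
      ring
    · rw [hq.eq_add_integral hL hρc hy]
      ring
  · rw [energy]
    congr 2
    ext s
    ring

end HeteroElastic

/-! ### Comparison with the circle -/

theorem mainTheorem12 (L : ℝ) (hL : 0 < L) (ν c₀ : ℝ) (ω : ℤ) (hω : ω ≠ 0)
    (β : ℝ → ℝ) (hβ : ContDiff ℝ (⊤ : ℕ∞) β) (hβpos : ∀ x, 0 < β x) :
    (HeteroElastic.Admissible L ν ω (HeteroElastic.thetaC L ω) (HeteroElastic.rhoC ν) ∧
      ∫ s in (0 : ℝ)..L, HeteroElastic.thetaC L ω s = Real.pi * ω * L) ∧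
    ∃ μ₀ : ℝ, 0 < μ₀ ∧ ∀ μ : ℝ, μ₀ ≤ μ →
      ∀ θ ρ : ℝ → ℝ, HeteroElastic.Admissible L ν ω θ ρ →
        ∫ s in (0 : ℝ)..L, θ s = Real.pi * ω * L →
        ¬ (EqOn θ (HeteroElastic.thetaC L ω) (Icc 0 L) ∧
            EqOn ρ (HeteroElastic.rhoC ν) (Icc 0 L)) →
        HeteroElastic.energy L β c₀ μ (HeteroElastic.thetaC L ω) (HeteroElastic.rhoC ν) <
          HeteroElastic.energy L β c₀ μ θ ρ := by
  refine ⟨⟨HeteroElastic.admissible_circle hL ν hω, HeteroElastic.integral_thetaC hL ω⟩, ?_⟩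
  obtain ⟨m, K, hm, hK, hloc⟩ :=
    HeteroElastic.exists_local_bounds (contDiff_infty.mp hβ 2) hβpos ν
  set a := 2 * Real.pi * ω / L - c₀ with ha
  set C := a ^ 2 * K + 2 * a ^ 2 * K ^ 2 / m with hC
  have hC0 : 0 ≤ C := by positivity
  have hB := hβpos ν
  -- The first summand serves the case `L Q ≥ 1`, the second the case `L Q < 1`; the extra `1` gives
  -- strictness in both.
  refine ⟨β ν * a ^ 2 * L ^ 2 + C * L ^ 2 + 1, by positivity, fun μ hμ θ ρ hadm hθ hne => ?_⟩
  obtain ⟨r, q, ir, ir2, iq2, hr0, hθr, hρq, hE⟩ := hadm.exists_deriv hL hθ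
  have hCL : 0 ≤ C * L ^ 2 := by positivity
  have hBL : 0 ≤ β ν * a ^ 2 * L ^ 2 := by positivity
  rw [HeteroElastic.energy_circle hL, hE, ← ha]
  refine mul_lt_mul_of_pos_left ?_ (by norm_num)
  set R := ∫ s in (0 : ℝ)..L, r s ^ 2 with hR
  set Q := ∫ s in (0 : ℝ)..L, q s ^ 2 with hQ
  have hR0 : 0 ≤ R := intervalIntegral.integral_nonneg hL.le fun s _ => sq_nonneg _
  have hQ0 : 0 ≤ Q := intervalIntegral.integral_nonneg hL.le fun s _ => sq_nonneg _
  have hρc : ContinuousOn ρ (uIcc 0 L) := by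
    rw [uIcc_of_le hL.le]
    exact hadm.memW12_density.1
  have iar2 : IntervalIntegrable (fun s => (a + r s) ^ 2) volume 0 L := by
    have e : (fun s => (a + r s) ^ 2) = fun s => a ^ 2 + 2 * a * r s + r s ^ 2 := by
      ext s
      ring
    rw [e]
    exact (intervalIntegrable_const.add (ir.const_mul _)).add ir2
  have ib : IntervalIntegrable (fun s => β (ρ s) * (a + r s) ^ 2) volume 0 L :=
    iar2.continuousOn_mul (hβ.continuous.comp_continuousOn hρc)
  rw [intervalIntegral.integral_add ib (iq2.const_mul _), intervalIntegral.integral_const_mul,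
    ← hQ]
  rcases le_or_gt 1 (L * Q) with hLQ | hLQ
  · have h1 : 0 ≤ ∫ s in (0 : ℝ)..L, β (ρ s) * (a + r s) ^ 2 :=
      intervalIntegral.integral_nonneg hL.le fun s _ =>
        mul_nonneg (hβpos _).le (sq_nonneg _)
    have hQpos : 0 < Q := pos_of_mul_pos_right (zero_lt_one.trans_le hLQ) hL.le
    have h2 : (β ν * a ^ 2 * L ^ 2 + 1) * Q ≤ μ * Q :=
      mul_le_mul_of_nonneg_right (by linarith) hQ0
    have h3 : β ν * a ^ 2 * L * 1 ≤ β ν * a ^ 2 * L * (L * Q) :=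
      mul_le_mul_of_nonneg_left hLQ (by positivity)
    linarith
  · have hη : ∀ s ∈ Icc 0 L, |ρ s - ν| ≤ 1 := fun s hs =>
      abs_le_one_iff_mul_self_le_one.mpr (by linarith [hρq s hs, sq (ρ s - ν)])
    have iη : IntervalIntegrable (fun s => ρ s - ν) volume 0 L :=
      (hρc.sub continuousOn_const).intervalIntegrable
    have iη2 : IntervalIntegrable (fun s => (ρ s - ν) ^ 2) volume 0 L :=
      ((hρc.sub continuousOn_const).pow 2).intervalIntegrable
    have hη0 : ∫ s in (0 : ℝ)..L, (ρ s - ν) = 0 := by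
      rw [intervalIntegral.integral_sub hρc.intervalIntegrable intervalIntegrable_const,
        hadm.mass, intervalIntegral.integral_const, smul_eq_mul]
      ring
    have hη2 : ∫ s in (0 : ℝ)..L, (ρ s - ν) ^ 2 ≤ L * (L * Q) := by
      have := intervalIntegral.integral_mono_on hL.le iη2
        (intervalIntegrable_const (c := L * Q)) hρq
      rwa [intervalIntegral.integral_const, smul_eq_mul, sub_zero] at this
    have i1 : IntervalIntegrable (fun s => β ν * a ^ 2 + a ^ 2 * deriv β ν * (ρ s - ν))
      volume 0 L := intervalIntegrable_const.add (iη.const_mul _)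
    have i2 := i1.add (ir.const_mul (2 * a * β ν))
    have i3 := i2.add (ir2.const_mul (m / 2))
    have i4 := i3.sub (iη2.const_mul C)
    have hlow := intervalIntegral.integral_mono_on hL.le i4 ib fun s hs =>
      HeteroElastic.energy_density_lower_bound (a := a) (r := r s) hm (hloc _ (hη s hs)).1
        (hloc _ (hη s hs)).2.1 (hloc _ (hη s hs)).2.2
    rw [intervalIntegral.integral_sub i3 (iη2.const_mul C),
      intervalIntegral.integral_add i2 (ir2.const_mul (m / 2)),
      intervalIntegral.integral_add i1 (ir.const_mul (2 * a * β ν)),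
      intervalIntegral.integral_add intervalIntegrable_const (iη.const_mul _),
      intervalIntegral.integral_const_mul, intervalIntegral.integral_const_mul,
      intervalIntegral.integral_const_mul, intervalIntegral.integral_const_mul,
      intervalIntegral.integral_const_mul, intervalIntegral.integral_const, hη0, hr0, smul_eq_mul, sub_zero, ← hR] at hlow
    have h1 : C * ∫ s in (0 : ℝ)..L, (ρ s - ν) ^ 2 ≤ C * (L * (L * Q)) :=
      mul_le_mul_of_nonneg_left hη2 hC0
    have h2 : (C * L ^ 2 + 1) * Q ≤ μ * Q := mul_le_mul_of_nonneg_right (by linarith) hQ0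
    -- This is the surplus over the circle's energy, up to the factor `1/2`; if it vanished, the
    -- pointwise Poincaré bounds would give the circle itself.
    have hpos : 0 < m / 2 * R + Q := by
      rcases hR0.eq_or_lt with hR' | hR'
      · rcases hQ0.eq_or_lt with hQ' | hQ'
        · refine absurd ⟨fun s hs => ?_, fun s hs => ?_⟩ hne
          · have := hθr s hs
            rw [← hR', mul_zero] at this
            exact sub_eq_zero.mp (pow_eq_zero_iff two_ne_zero |>.mp
              (le_antisymm this (sq_nonneg _)))
          · have := hρq s hs
            rw [← hQ', mul_zero] at this
            exact sub_eq_zero.mp (pow_eq_zero_iff two_ne_zero |>.mp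
              (le_antisymm this (sq_nonneg _)))
        · positivity
      · positivity
    linarith
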